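/- **Unit-cube contact representations of subgraphs of grids.** Let $\Gamma$ be one of the following three infinite planar graphs: the square grid (the graph on $\mathbb{Z}^2$ in which two points are adjacent if and only if their distance is $1$), the hexagonal grid (the graph of the tiling of the plane by regular hexagons, three at each vertex), or the octagonal-square grid (the graph of the tiling of the plane by squares and regular octagons, with one square and two octagons at each vertex). Then every (not necessarily induced, finite or infinite) subgraph $G$ of $\Gamma$ has a contact representation by unit cubes: one can assign to each vertex $v$ of $G$ a closed axis-aligned cube $Q_v\subset\mathbb{R}^3$ of side length $1$ so that, for any two distinct vertices $u,v$ of $G$, the cubes $Q_u$ and $Q_v$ have disjoint interiors, and $u$ and $v$ are adjacent in $G$ if and only if the common boundary $\partial Q_u\cap\partial Q_v$ has positive area. -/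

import Mathlib

open scoped MeasureTheory

/-- The (infinite) square grid: the points of `ℤ × ℤ`, where two points are adjacent if and only if
they are at distance one. -/
def squareGrid : SimpleGraph (ℤ × ℤ) where
  Adj u v := |u.1 - v.1| + |u.2 - v.2| = 1
  symm := ⟨fun u v h => by rwa [abs_sub_comm v.1 u.1, abs_sub_comm v.2 u.2]⟩
  loopless := ⟨fun u h => by simp at h⟩

/-- The (infinite) hexagonal grid, as the dual of the triangular grid on `ℤ × ℤ`.
The vertex `(a, b, false)` is the triangle with corners `(a, b)`, `(a + 1, b)`, `(a, b + 1)`, the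
vertex `(a, b, true)` is the triangle with corners `(a + 1, b + 1)`, `(a + 1, b)`, `(a, b + 1)`, and
two triangles are adjacent if and only if they share a side. -/
def hexagonalGrid : SimpleGraph (ℤ × ℤ × Bool) :=
  SimpleGraph.fromRel fun u v =>
    u.2.2 = false ∧ v.2.2 = true ∧
      ((v.1 = u.1 ∧ v.2.1 = u.2.1) ∨
        (v.1 = u.1 - 1 ∧ v.2.1 = u.2.1) ∨
        (v.1 = u.1 ∧ v.2.1 = u.2.1 - 1))

/-- The (infinite) octagonal-square grid (the graph of the truncated square tiling).
The cell `(a, b)` holds a square whose corners `(a, b, 0)`, `(a, b, 1)`, `(a, b, 2)`, `(a, b, 3)`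
point east, north, west and south, and are joined in this cyclic order (`+ 1` on `Fin 4` is
addition modulo `4`); the east corner of each cell is joined to
the west corner of the cell to its right, and the north corner of each cell is joined to the south
corner of the cell above it. -/
def octagonalSquareGrid : SimpleGraph (ℤ × ℤ × Fin 4) :=
  SimpleGraph.fromRel fun u v =>
    (v.1 = u.1 ∧ v.2.1 = u.2.1 ∧ v.2.2 = u.2.2 + 1) ∨
      (u.2.2 = 0 ∧ v.2.2 = 2 ∧ v.1 = u.1 + 1 ∧ v.2.1 = u.2.1) ∨
      (u.2.2 = 1 ∧ v.2.2 = 3 ∧ v.1 = u.1 ∧ v.2.1 = u.2.1 + 1)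

/-- The closed axis-aligned unit cube in three-dimensional Euclidean space with minimal corner
`p`. -/
def unitCube (p : EuclideanSpace ℝ (Fin 3)) : Set (EuclideanSpace ℝ (Fin 3)) :=
  {x | ∀ i, p i ≤ x i ∧ x i ≤ p i + 1}

/-- Assigning to each vertex `v` of `G` the unit cube with minimal corner `p v` is a contact
representation of `G`: distinct cubes have disjoint interiors, and two distinct vertices are
adjacent if and only if the boundaries of their cubes share a set of positive area
(two-dimensional Hausdorff measure). -/
structure IsUnitCubeContactRep {V : Type*} (G : SimpleGraph V)
    (p : V → EuclideanSpace ℝ (Fin 3)) : Prop where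
  disjoint_interior : ∀ u v : V, u ≠ v →
    Disjoint (interior (unitCube (p u))) (interior (unitCube (p v)))
  adj_iff : ∀ u v : V, u ≠ v →
    (G.Adj u v ↔ 0 < μH[2] (frontier (unitCube (p u)) ∩ frontier (unitCube (p v))))

/-- `G` has a contact representation by unit cubes. -/
def HasUnitCubeContactRep {V : Type*} (G : SimpleGraph V) : Prop :=
  ∃ p : V → EuclideanSpace ℝ (Fin 3), IsUnitCubeContactRep G p

/-! All three grids embed in the square grid, and non-induced subgraphs are allowed, so it suffices
to represent every spanning subgraph of the square grid and then restrict to vertices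
(`hasUnitCubeContactRep_coe`). For that, shear the lattice into space as a staircase in which grid
neighbours touch face to face and all other pairs are strictly apart. Sliding the cubes along each
row and column by small monotone shifts (`exists_bounded_shift`) opens a gap exactly at the missing
edges; the slack in the staircase absorbs the shifts everywhere else. -/

theorem exists_bounded_shift (M : Set ℤ) :
    ∃ s : ℤ → ℝ, (∀ i, |s i| < 1 / 10) ∧ (∀ i ∈ M, s i < s (i + 1)) ∧
      ∀ i, i ∉ M → s (i + 1) = s i := by
  classical
  obtain ⟨g, hg⟩ : ∃ g : ℤ → ℤ, ∀ i, g (i + 1) = g i + if i ∈ M then 1 else 0 := by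
    -- The signed number of elements of `M` between `0` and `i`.
    refine ⟨fun i => ∑ k ∈ Finset.Ico 0 i, (if k ∈ M then 1 else 0) -
      ∑ k ∈ Finset.Ico i 0, (if k ∈ M then 1 else 0), fun i => ?_⟩
    rcases le_or_gt 0 i with h | h
    · have h1 : Finset.Ico 0 (i + 1) = insert i (Finset.Ico 0 i) := by
        ext k; simp only [Finset.mem_Ico, Finset.mem_insert]; omega
      have h2 : Finset.Ico (i + 1) 0 = ∅ := Finset.Ico_eq_empty (by omega)
      have h3 : Finset.Ico i 0 = ∅ := Finset.Ico_eq_empty (by omega)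
      simp only [h1, h2, h3]
      rw [Finset.sum_insert (by simp)]
      simp [add_comm]
    · have h1 : Finset.Ico i 0 = insert i (Finset.Ico (i + 1) 0) := by
        ext k; simp only [Finset.mem_Ico, Finset.mem_insert]; omega
      have h2 : Finset.Ico 0 (i + 1) = ∅ := Finset.Ico_eq_empty (by omega)
      have h3 : Finset.Ico 0 i = ∅ := Finset.Ico_eq_empty (by omega)
      simp only [h1, h2, h3]
      rw [Finset.sum_insert (by simp)]
      simp
  -- `arctan` makes the count bounded while keeping it strictly monotone; `π / 40 < 1 / 10`.
  refine ⟨fun i => Real.arctan (g i) / 20, fun i => ?_, fun i hi => ?_, fun i hi => ?_⟩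
  · have h1 := Real.arctan_lt_pi_div_two (g i)
    have h2 := Real.neg_pi_div_two_lt_arctan (g i)
    have h3 := Real.pi_lt_four
    rw [abs_lt]
    constructor <;> linarith
  · have : (g i : ℝ) < g (i + 1) := by
      rw [hg, if_pos hi]; push_cast; linarith
    have := Real.arctan_strictMono this
    show Real.arctan (g i) / 20 < Real.arctan (g (i + 1)) / 20
    linarith
  · simp [hg, hi]

/-! ### Contact and separation of unit cubes -/

theorem isClosed_unitCube (p : EuclideanSpace ℝ (Fin 3)) : IsClosed (unitCube p) := by
  have : unitCube p = ⋂ i, {x | p i ≤ x i ∧ x i ≤ p i + 1} := by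
    ext x; simp [unitCube]
  rw [this]
  refine isClosed_iInter fun i => ?_
  have hi : Continuous fun x : EuclideanSpace ℝ (Fin 3) => x i := by fun_prop
  exact (isClosed_le continuous_const hi).inter (isClosed_le hi continuous_const)

theorem interior_unitCube_subset (p : EuclideanSpace ℝ (Fin 3)) :
    interior (unitCube p) ⊆ {x | ∀ i, p i < x i ∧ x i < p i + 1} := by
  intro x hx i
  have hmap : IsOpenMap fun y : EuclideanSpace ℝ (Fin 3) => y i :=
    (isOpenMap_eval i).comp (EuclideanSpace.equiv (Fin 3) ℝ).toHomeomorph.isOpenMap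
  have himg : (fun y : EuclideanSpace ℝ (Fin 3) => y i) '' interior (unitCube p) ⊆
      Set.Icc (p i) (p i + 1) := by
    rintro _ ⟨y, hy, rfl⟩
    exact interior_subset hy i
  have := interior_maximal himg (hmap _ isOpen_interior) ⟨x, hx, rfl⟩
  rwa [interior_Icc] at this

theorem disjoint_interior_unitCube {p q : EuclideanSpace ℝ (Fin 3)} {i : Fin 3}
    (h : 1 ≤ |q i - p i|) : Disjoint (interior (unitCube p)) (interior (unitCube q)) := by
  rw [Set.disjoint_left]
  intro x hp hq
  have h1 := interior_unitCube_subset p hp i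
  have h2 := interior_unitCube_subset q hq i
  rcases le_abs.1 h with h | h <;> linarith [h1.1, h1.2, h2.1, h2.2]

theorem frontier_unitCube_inter_eq_empty {p q : EuclideanSpace ℝ (Fin 3)} {i : Fin 3}
    (h : 1 < |q i - p i|) : frontier (unitCube p) ∩ frontier (unitCube q) = ∅ := by
  rw [Set.eq_empty_iff_forall_notMem]
  rintro x ⟨hp, hq⟩
  have h1 := (isClosed_unitCube p).frontier_subset hp i
  have h2 := (isClosed_unitCube q).frontier_subset hq i
  rcases lt_abs.1 h with h | h <;> linarith [h1.1, h1.2, h2.1, h2.2]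

theorem mem_frontier_unitCube {p x : EuclideanSpace ℝ (Fin 3)} (hx : x ∈ unitCube p) {i : Fin 3}
    (hi : x i = p i ∨ x i = p i + 1) : x ∈ frontier (unitCube p) := by
  rw [(isClosed_unitCube p).frontier_eq]
  refine ⟨hx, fun h => ?_⟩
  have := interior_unitCube_subset p h i
  rcases hi with hi | hi <;> linarith [this.1, this.2]

/-- Two unit cubes that touch along overlapping faces share a set of positive area. -/
theorem hausdorffMeasure_frontier_inter_pos {p q : EuclideanSpace ℝ (Fin 3)} (i : Fin 3)
    (hi : q i = p i + 1) (hj : ∀ j, j ≠ i → |q j - p j| < 1) :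
    0 < μH[2] (frontier (unitCube p) ∩ frontier (unitCube q)) := by
  -- Forgetting coordinate `i` is 1-Lipschitz, so it does not increase `μH[2]`, and the image
  -- contains a nondegenerate rectangle.
  let π : EuclideanSpace ℝ (Fin 3) → (Fin 2 → ℝ) := fun x k => x (i.succAbove k)
  have hπ : LipschitzWith 1 π := by
    refine LipschitzWith.of_dist_le_mul fun x y => ?_
    rw [NNReal.coe_one, one_mul, dist_pi_le_iff dist_nonneg]
    intro k
    rw [dist_eq_norm, dist_eq_norm]
    exact PiLp.norm_apply_le (x - y) (i.succAbove k)
  let a : Fin 2 → ℝ := fun k => max (p (i.succAbove k)) (q (i.succAbove k))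
  let b : Fin 2 → ℝ := fun k => min (p (i.succAbove k)) (q (i.succAbove k)) + 1
  have hab : ∀ k, a k < b k := by
    intro k
    have := abs_lt.1 (hj _ (i.succAbove_ne k))
    simp only [a, b, max_lt_iff, ← min_add_add_right, lt_min_iff]
    refine ⟨⟨?_, ?_⟩, ?_, ?_⟩ <;> linarith [this.1, this.2]
  have hsub : Set.Icc a b ⊆ π '' (frontier (unitCube p) ∩ frontier (unitCube q)) := by
    intro y hy
    let x : EuclideanSpace ℝ (Fin 3) := WithLp.toLp 2 (i.insertNth (q i) y)
    have hxi : x i = q i := by simp [x]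
    have hxk : ∀ k, x (i.succAbove k) = y k := fun k => by simp [x]
    have hbd : ∀ k, (p (i.succAbove k) ≤ y k ∧ y k ≤ p (i.succAbove k) + 1) ∧
        (q (i.succAbove k) ≤ y k ∧ y k ≤ q (i.succAbove k) + 1) := by
      intro k
      have h1 := hy.1 k
      have h2 := hy.2 k
      simp only [a, b, max_le_iff, ← min_add_add_right, le_min_iff] at h1 h2
      exact ⟨⟨h1.1, h2.1⟩, h1.2, h2.2⟩
    refine ⟨x, ⟨mem_frontier_unitCube (i := i) ?_ (Or.inr (hxi.trans hi)),
      mem_frontier_unitCube (i := i) ?_ (Or.inl hxi)⟩, funext hxk⟩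
    · intro j
      rcases i.eq_self_or_eq_succAbove j with rfl | ⟨k, rfl⟩
      · rw [hxi]; constructor <;> linarith
      · rw [hxk]; exact (hbd k).1
    · intro j
      rcases i.eq_self_or_eq_succAbove j with rfl | ⟨k, rfl⟩
      · rw [hxi]; constructor <;> linarith
      · rw [hxk]; exact (hbd k).2
  have hpos : 0 < μH[2] (Set.Icc a b) := by
    have h2 : (2 : ℝ) = (Fintype.card (Fin 2) : ℝ) := by simp
    rw [h2, MeasureTheory.hausdorffMeasure_pi_real, Real.volume_Icc_pi]
    refine CanonicallyOrderedAdd.prod_pos.2 fun k _ => ?_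
    simpa using hab k
  calc 0 < μH[2] (Set.Icc a b) := hpos
    _ ≤ μH[2] (π '' (frontier (unitCube p) ∩ frontier (unitCube q))) := MeasureTheory.measure_mono hsub
    _ ≤ _ := by simpa using hπ.hausdorffMeasure_image_le (d := 2) (by norm_num) _

/-- A family of unit cubes is a contact representation as soon as adjacent cubes touch along
overlapping faces and non-adjacent cubes are strictly separated in some coordinate. -/
theorem IsUnitCubeContactRep.of_separated {V : Type*} {G : SimpleGraph V}
    {p : V → EuclideanSpace ℝ (Fin 3)}
    (hadj : ∀ u v, G.Adj u v → ∃ i, |p v i - p u i| = 1 ∧ ∀ j, j ≠ i → |p v j - p u j| < 1)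
    (hsep : ∀ u v, u ≠ v → ¬ G.Adj u v → ∃ i, 1 < |p v i - p u i|) :
    IsUnitCubeContactRep G p where
  disjoint_interior u v huv := by
    by_cases h : G.Adj u v
    · obtain ⟨i, hi, -⟩ := hadj u v h
      exact disjoint_interior_unitCube hi.ge
    · obtain ⟨i, hi⟩ := hsep u v huv h
      exact disjoint_interior_unitCube hi.le
  adj_iff u v huv := by
    constructor
    · intro h
      obtain ⟨i, hi, hj⟩ := hadj u v h
      rcases (abs_eq zero_le_one).1 hi with hi | hi
      · exact hausdorffMeasure_frontier_inter_pos i (by linarith) hj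
      · rw [Set.inter_comm]
        exact hausdorffMeasure_frontier_inter_pos i (by linarith)
          fun j hji => by rw [abs_sub_comm]; exact hj j hji
    · intro h
      by_contra hn
      obtain ⟨i, hi⟩ := hsep u v huv hn
      simp [frontier_unitCube_inter_eq_empty hi] at h

theorem HasUnitCubeContactRep.of_embedding {V W : Type*} {G : SimpleGraph V} {H : SimpleGraph W}
    (f : G ↪g H) (h : HasUnitCubeContactRep H) : HasUnitCubeContactRep G := by
  obtain ⟨p, hp⟩ := h
  refine ⟨p ∘ f, fun u v huv => hp.disjoint_interior _ _ (f.injective.ne huv), fun u v huv => ?_⟩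
  rw [← f.map_adj_iff]
  exact hp.adj_iff _ _ (f.injective.ne huv)

/-! ### Subgraphs of the square grid -/

theorem squareGrid_adj_cases {u v : ℤ × ℤ} (h : squareGrid.Adj u v) :
    (v = (u.1 + 1, u.2) ∨ u = (v.1 + 1, v.2)) ∨ (v = (u.1, u.2 + 1) ∨ u = (v.1, v.2 + 1)) := by
  obtain ⟨a, b⟩ := u
  obtain ⟨c, d⟩ := v
  change |a - c| + |b - d| = 1 at h
  simp only [Prod.mk.injEq]
  grind

theorem hasUnitCubeContactRep_of_le_squareGrid {H : SimpleGraph (ℤ × ℤ)} (hH : H ≤ squareGrid) :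
    HasUnitCubeContactRep H := by
  choose s hs hsM hsN using fun j : ℤ => exists_bounded_shift {i | ¬ H.Adj (i, j) (i + 1, j)}
  choose t ht htM htN using fun i : ℤ => exists_bounded_shift {j | ¬ H.Adj (i, j) (i, j + 1)}
  -- Height `3/5` per diagonal keeps consecutive diagonals within `1` and puts diagonals two apart
  -- at distance `6/5`. The shear `3/10` spaces points of one diagonal by `13/10` in the first
  -- coordinate, which beats the total shift `2/10`.
  let p : ℤ × ℤ → EuclideanSpace ℝ (Fin 3) := fun u =>
    !₂[u.1 - 3 / 10 * u.2 + s u.2 u.1, u.2 + t u.1 u.2, 3 / 5 * (u.1 + u.2)]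
  have hp0 : ∀ u, p u 0 = u.1 - 3 / 10 * u.2 + s u.2 u.1 := fun u => rfl
  have hp1 : ∀ u, p u 1 = u.2 + t u.1 u.2 := fun u => rfl
  have hp2 : ∀ u, p u 2 = 3 / 5 * (u.1 + u.2) := fun u => rfl
  have hs' := fun j i => abs_lt.1 (hs j i)
  have ht' := fun i j => abs_lt.1 (ht i j)
  have hright : ∀ i j, H.Adj (i, j) (i + 1, j) → ∃ k, |p (i + 1, j) k - p (i, j) k| = 1 ∧
      ∀ l, l ≠ k → |p (i + 1, j) l - p (i, j) l| < 1 := by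
    intro i j h
    refine ⟨0, ?_, fun l hl => ?_⟩
    · have := hsN j i (by simpa using h)
      simp only [hp0, this]; push_cast; ring_nf; norm_num
    · fin_cases l
      · simp at hl
      · change |p (i + 1, j) 1 - p (i, j) 1| < 1
        simp only [hp1]
        rw [abs_lt]
        constructor <;> linarith [ht' i j, ht' (i + 1) j]
      · change |p (i + 1, j) 2 - p (i, j) 2| < 1
        simp only [hp2]
        rw [abs_lt]; push_cast
        constructor <;> linarith
  have hup : ∀ i j, H.Adj (i, j) (i, j + 1) → ∃ k, |p (i, j + 1) k - p (i, j) k| = 1 ∧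
      ∀ l, l ≠ k → |p (i, j + 1) l - p (i, j) l| < 1 := by
    intro i j h
    refine ⟨1, ?_, fun l hl => ?_⟩
    · have := htN i j (by simpa using h)
      simp only [hp1, this]; push_cast; ring_nf; norm_num
    · fin_cases l
      · change |p (i, j + 1) 0 - p (i, j) 0| < 1
        simp only [hp0]
        rw [abs_lt]; push_cast
        constructor <;> linarith [hs' j i, hs' (j + 1) i]
      · simp at hl
      · change |p (i, j + 1) 2 - p (i, j) 2| < 1
        simp only [hp2]
        rw [abs_lt]; push_cast
        constructor <;> linarith
  have hsep : ∀ u v : ℤ × ℤ, u ≠ v → u.1 + u.2 ≤ v.1 + v.2 → ¬ H.Adj u v →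
      ∃ i, 1 < |p v i - p u i| := by
    rintro ⟨a, b⟩ ⟨c, d⟩ huv hle hn
    dsimp only at hle
    have hsa := hs' b a
    have hsc := hs' d c
    obtain h2 | hlt : a + b + 2 ≤ c + d ∨ c + d < a + b + 2 := le_or_gt _ _
    · refine ⟨2, lt_abs.2 (Or.inl ?_)⟩
      have : (a : ℝ) + b + 2 ≤ c + d := by exact_mod_cast h2
      simp only [hp2]; linarith
    obtain h0 | h1 : c + d = a + b ∨ c + d = a + b + 1 := by omega
    · refine ⟨0, ?_⟩
      have h0' : (c : ℝ) + d = a + b := by exact_mod_cast h0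
      have hac : c ≠ a := by rintro rfl; exact huv (by simp; omega)
      simp only [hp0]
      rw [lt_abs]
      rcases lt_or_gt_of_ne hac with h | h
      · have : (c : ℝ) + 1 ≤ a := by exact_mod_cast h
        right; linarith
      · have : (a : ℝ) + 1 ≤ c := by exact_mod_cast h
        left; linarith
    -- On the next diagonal the unshifted first coordinates differ by `13/10 * (c - a) - 3/10`. Only
    -- `c = a` and `c = a + 1` are grid neighbours; there the edge is missing and the shift opens
    -- the gap.
    · have h1' : (c : ℝ) + d = a + b + 1 := by exact_mod_cast h1
      obtain h | rfl | rfl | h : c < a ∨ c = a ∨ c = a + 1 ∨ a + 2 ≤ c := by omega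
      · refine ⟨0, lt_abs.2 (Or.inr ?_)⟩
        have : (c : ℝ) + 1 ≤ a := by exact_mod_cast h
        simp only [hp0]; linarith
      · obtain rfl : d = b + 1 := by omega
        refine ⟨1, lt_abs.2 (Or.inl ?_)⟩
        have := htM c b hn
        simp only [hp1]; push_cast; linarith
      · obtain rfl : d = b := by omega
        refine ⟨0, lt_abs.2 (Or.inl ?_)⟩
        have := hsM d a hn
        simp only [hp0]; push_cast; linarith
      · refine ⟨0, lt_abs.2 (Or.inl ?_)⟩
        have : (a : ℝ) + 2 ≤ c := by exact_mod_cast h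
        simp only [hp0]; linarith
  refine ⟨p, .of_separated (fun u v h => ?_) fun u v huv hn => ?_⟩
  · rcases squareGrid_adj_cases (hH h) with (h' | h') | (h' | h')
    · rw [h'] at h ⊢
      exact hright _ _ h
    · rw [h'] at h ⊢
      obtain ⟨k, hk, hl⟩ := hright _ _ h.symm
      exact ⟨k, by rwa [abs_sub_comm], fun l hlk => by rw [abs_sub_comm]; exact hl l hlk⟩
    · rw [h'] at h ⊢
      exact hup _ _ h
    · rw [h'] at h ⊢
      obtain ⟨k, hk, hl⟩ := hup _ _ h.symm
      exact ⟨k, by rwa [abs_sub_comm], fun l hlk => by rw [abs_sub_comm]; exact hl l hlk⟩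
  · rcases le_total (u.1 + u.2) (v.1 + v.2) with h | h
    · exact hsep u v huv h hn
    · obtain ⟨i, hi⟩ := hsep v u huv.symm h fun h => hn h.symm
      exact ⟨i, by rwa [abs_sub_comm]⟩

/-! ### Transfer to the other grids -/

/-- Every subgraph of a graph that maps injectively and adjacency-preservingly to the square grid
has a contact representation by unit cubes. -/
theorem hasUnitCubeContactRep_coe {V : Type*} {Γ : SimpleGraph V} (φ : Γ →g squareGrid)
    (hφ : Function.Injective φ) (G : Γ.Subgraph) : HasUnitCubeContactRep G.coe := by
  let f : G.verts ↪ ℤ × ℤ := ⟨fun v => φ v, fun u v h => Subtype.ext (hφ h)⟩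
  refine .of_embedding (SimpleGraph.Embedding.map f G.coe)
    (hasUnitCubeContactRep_of_le_squareGrid ?_)
  rw [SimpleGraph.map_le_iff_le_comap]
  exact fun u v h => φ.map_adj h.adj_sub

/-- The hexagonal grid drawn as a brick wall in the square grid. -/
def hexagonalGridToSquareGrid : hexagonalGrid →g squareGrid where
  toFun u := (2 * u.1 + u.2.1 + (if u.2.2 then 1 else 0), u.2.1)
  map_rel' := by
    rintro ⟨a, b, s⟩ ⟨c, d, t⟩ ⟨-, h⟩
    change |_ - _| + |_ - _| = (1 : ℤ)
    dsimp only at h ⊢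
    rcases h with ⟨rfl, rfl, h⟩ | ⟨rfl, rfl, h⟩ <;> simp <;> grind

theorem hexagonalGridToSquareGrid_injective :
    Function.Injective hexagonalGridToSquareGrid := by
  rintro ⟨a, b, s⟩ ⟨c, d, t⟩ h
  change (_, _) = (_, _) at h
  -- The parity of the sum of the two image coordinates recovers the Boolean.
  cases s <;> cases t <;> simp at h ⊢ <;> omega

/-- The octagonal-square grid in the square grid: each square becomes a unit square of the
lattice, and the cells are translated along the vectors `(2, -1)` and `(1, 2)`. -/
def octagonalSquareGridToSquareGrid : octagonalSquareGrid →g squareGrid where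
  toFun u := (2 * u.1 + u.2.1 + ![1, 1, 0, 0] u.2.2, 2 * u.2.1 - u.1 + ![0, 1, 1, 0] u.2.2)
  map_rel' := by
    rintro ⟨a, b, s⟩ ⟨c, d, t⟩ ⟨-, h⟩
    change |_ - _| + |_ - _| = (1 : ℤ)
    dsimp only at h ⊢
    rcases h with (⟨rfl, rfl, rfl⟩ | ⟨rfl, rfl, rfl, rfl⟩ | ⟨rfl, rfl, rfl, rfl⟩) |
      (⟨rfl, rfl, rfl⟩ | ⟨rfl, rfl, rfl, rfl⟩ | ⟨rfl, rfl, rfl, rfl⟩)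
    · fin_cases s <;> simp
    · simp; grind
    · simp; grind
    · fin_cases t <;> simp
    · simp; grind
    · simp; grind

theorem octagonalSquareGridToSquareGrid_injective :
    Function.Injective octagonalSquareGridToSquareGrid := by
  rintro ⟨a, b, s⟩ ⟨c, d, t⟩ h
  change (_, _) = (_, _) at h
  -- The translations span a sublattice of index `5`, and the residue of `x + 2 * y` modulo `5`
  -- tells the four corners apart.
  fin_cases s <;> fin_cases t <;> simp at h ⊢ <;> omega

theorem mainTheorem3 :
    (∀ G : squareGrid.Subgraph, HasUnitCubeContactRep G.coe) ∧
      (∀ G : hexagonalGrid.Subgraph, HasUnitCubeContactRep G.coe) ∧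
      (∀ G : octagonalSquareGrid.Subgraph, HasUnitCubeContactRep G.coe) :=
  ⟨hasUnitCubeContactRep_coe .id Function.injective_id,
    hasUnitCubeContactRep_coe _ hexagonalGridToSquareGrid_injective,
    hasUnitCubeContactRep_coe _ octagonalSquareGridToSquareGrid_injective⟩
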